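/- Setting. Let $G$ be a Lie group with Lie algebra $\mathfrak g$ (a complex Lie group is regarded as a real one), $M$ a smooth $n$-manifold, and $\pi:P\to M$ a smooth principal $G$-bundle. Denote by $\operatorname{Conn}(P)$ its connection 1-forms and by $F_D=d_DD$ the curvature of $D\in\operatorname{Conn}(P)$, where $d_D\alpha$ is the horizontal part of $d\alpha$. Let $\langle\cdot,\cdot\rangle$ be an $\mathbb R$-bilinear pairing on the horizontal equivariant $\mathfrak g$-valued 2-forms of $P$ with values in the smooth 1-densities on $M$, such that $\langle F_D,F_D\rangle$ is integrable for every $D$, and let $S^G:\operatorname{Conn}(P)\to\mathbb R$, $S^G(D)=\int_M\langle F_D,F_D\rangle$ (a Yang–Mills-type theory). Let $\imath:G\hookrightarrow\hat G$ be an injective Lie group homomorphism and $\hat P=P\times_G\hat G$ the induced principal $\hat G$-bundle. Let $\Gamma=\operatorname{Gau}_{\hat G}(\hat P)$ be the group of automorphisms of $\hat P$ over $\mathrm{id}_M$, acting by pullback on the space $\Omega^1(\hat P;\hat{\mathfrak g})$ of smooth $\hat{\mathfrak g}$-valued 1-forms. An extension of $S^G$ consists of a $\Gamma$-invariant set $X$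 with $\operatorname{Conn}(\hat P)\subseteq X\subseteq\Omega^1(\hat P;\hat{\mathfrak g})$ (the extended domain), a $\Gamma$-invariant function $\hat S:X\to\mathbb R$, a subset $C^1\subseteq X$ (the correction subspace), a function $C:C^1\to\mathbb R$ and a map $\delta:C^1\to\operatorname{Conn}(P)$ with $\hat S|_{C^1}=S^G\circ\delta+C$. It is complete if $C=0$. It is an extension with equivariant domain if $X\subseteq\Omega^1_{eq}(\hat P;\hat{\mathfrak g})$, the set of equivariant 1-forms. Let $S:\Omega^1(\hat P;\hat{\mathfrak g})\to\mathbb R$ be a function and let $X_0$ with $\operatorname{Conn}(\hat P)\subseteq X_0\subseteq\Omega^1(\hat P;\hat{\mathfrak g})$ be an injective $\Gamma$-invariant subset for $S$: $X_0$ is $\Gamma$-invariant, $S$ is constant on the $\Gamma$-orbits in $X_0$, and the induced map $\overline S_0:X_0/\Gamma\to\mathbb R$ is injective. Let $\overline{\jmath}:\operatorname{Conn}(\hat P)/\Gamma\to X_0/\Gamma$ be induced by the inclusion and $\overline S_{0,\jmath}=\overline S_0\circ\overline\jmath$. Let $$\operatorname{Pb}=\{(D,c)\in\operatorname{Conn}(P)\times\operatorname{Conn}(\hat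 P)/\Gamma : S^G(D)=\overline S_{0,\jmath}(c)\}$$ be the pullback of $S^G$ and $\overline S_{0,\jmath}$. For a gauge fixing $\sigma$ in $\operatorname{Conn}(\hat P)$, i.e. a section of $\operatorname{Conn}(\hat P)\to\operatorname{Conn}(\hat P)/\Gamma$, let $X_0(\sigma)\subseteq X_0$ be the image of the map $\operatorname{Pb}\to X_0$, $(D,c)\mapsto\sigma(c)$. Lemma. The map $\overline S_{0,\jmath}$ is injective, and: 1. For every gauge fixing $\sigma$ in $\operatorname{Conn}(\hat P)$, the restriction $S_0=S|_{X_0}$ is the extended action functional of a complete extension of $S^G$ with extended domain $X_0$ and correction subspace $X_0(\sigma)$. Its map $\delta$ comes from the pullback: every $\alpha\in X_0(\sigma)$ is the image of some $(D,c)\in\operatorname{Pb}$ with $D=\delta(\alpha)$. If $X_0\subseteq\Omega^1_{eq}(\hat P;\hat{\mathfrak g})$, then this is an extension with equivariant domain. 2. For any two gauge fixings $\sigma,\sigma'$ in $\operatorname{Conn}(\hat P)$ there is a bijection $X_0(\sigma)\simeq X_0(\sigma')$. -/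

import Mathlib

open scoped Manifold ContDiff Topology

set_option linter.unusedSectionVars false

namespace YangMills
noncomputable section

section Forms

variable {E : Type*} [NormedAddCommGroup E] [NormedSpace ℝ E]
  {P : Type*} [TopologicalSpace P] [ChartedSpace E P]
  {E' : Type*} [NormedAddCommGroup E'] [NormedSpace ℝ E']
  {P' : Type*} [TopologicalSpace P'] [ChartedSpace E' P']
  {E'' : Type*} [NormedAddCommGroup E''] [NormedSpace ℝ E'']
  {P'' : Type*} [TopologicalSpace P''] [ChartedSpace E'' P'']
  {V : Type*} [NormedAddCommGroup V] [NormedSpace ℝ V]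

variable (E E') in
/-- The differential `T_p f : T_p P → T_{f p} P'`. In Mathlib, the tangent spaces of a manifold
modelled on `E` are by definition copies of `E`; all tangent vectors below are elements of `E`. -/
def tmap (f : P → P') (p : P) : E →L[ℝ] E' := mfderiv 𝓘(ℝ, E) 𝓘(ℝ, E') f p

variable (E P V) in
/-- Not necessarily smooth `V`-valued `k`-forms on `P`: a continuous alternating map on `T_p P = E`
for every point `p`. -/
abbrev RawForm (k : ℕ) : Type _ := P → E [⋀^Fin k]→L[ℝ] V

namespace RawForm

variable {k : ℕ}

/-- The expression of a form in a chart `c`. -/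
def rep (α : RawForm E P V k) (c : OpenPartialHomeomorph P E) : E → E [⋀^Fin k]→L[ℝ] V :=
  fun y => (α (c.symm y)).compContinuousLinearMap (tmap E E c.symm y)

/-- A form is smooth if its expressions in charts are smooth. -/
def IsSmooth (α : RawForm E P V k) : Prop :=
  ∀ x : P, ContDiffOn ℝ ∞ (α.rep (chartAt E x)) (chartAt E x).target

/-- The pullback `f^* α`. -/
def pullback (f : P → P') (α : RawForm E' P' V k) : RawForm E P V k :=
  fun p => (α (f p)).compContinuousLinearMap (tmap E E' f p)

/-- The exterior derivative, computed at `p` in the chart at `p`; `rep_extD` shows that every chart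
gives the same result. -/
def extD (α : RawForm E P V k) : RawForm E P V (k + 1) :=
  fun p => (extDeriv (α.rep (chartAt E p)) (chartAt E p p)).compContinuousLinearMap
    (tmap E E (chartAt E p) p)

end RawForm

theorem tmap_comp {g : P' → P''} {f : P → P'} {p : P}
    (hg : MDifferentiableAt 𝓘(ℝ, E') 𝓘(ℝ, E'') g (f p))
    (hf : MDifferentiableAt 𝓘(ℝ, E) 𝓘(ℝ, E') f p) :
    tmap E E'' (fun q => g (f q)) p = (tmap E' E'' g (f p)).comp (tmap E E' f p) :=
  mfderiv_comp p hg hf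

theorem tmap_congr {f g : P → P'} {p : P} (h : f =ᶠ[𝓝 p] g) : tmap E E' f p = tmap E E' g p :=
  Filter.EventuallyEq.mfderiv_eq h

theorem tmap_id (p : P) : tmap E E (fun q : P => q) p = ContinuousLinearMap.id ℝ E :=
  mfderiv_id

theorem tmap_eq_fderiv (f : E → E') (y : E) : tmap E E' f y = fderiv ℝ f y := mfderiv_eq_fderiv

theorem contDiffAt_compAlt {k : ℕ} [FiniteDimensional ℝ E] [FiniteDimensional ℝ E'] [FiniteDimensional ℝ V]
    {X : Type*} [NormedAddCommGroup X] [NormedSpace ℝ X] {A : X → E' [⋀^Fin k]→L[ℝ] V}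
    {T : X → E →L[ℝ] E'} {x : X} (hA : ContDiffAt ℝ ∞ A x) (hT : ContDiffAt ℝ ∞ T x) :
    ContDiffAt ℝ ∞ (fun y => (A y).compContinuousLinearMap (T y)) x := by
  have : FiniteDimensional ℝ (ContinuousMultilinearMap ℝ (fun _ : Fin k => E) V) :=
    Module.Finite.of_injective
      (ContinuousMultilinearMap.toMultilinearMapLinear (R' := ℝ) (A := ℝ)
        (M₁ := fun _ : Fin k => E) (M₂ := V)) ContinuousMultilinearMap.toMultilinearMap_injective
  let toC : (E [⋀^Fin k]→L[ℝ] V) →L[ℝ] ContinuousMultilinearMap ℝ (fun _ : Fin k => E) V :=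
    ContinuousAlternatingMap.toContinuousMultilinearMapCLM ℝ
  have hinj : Function.Injective toC := fun a b hab =>
    ContinuousAlternatingMap.toContinuousMultilinearMap_injective hab
  obtain ⟨l, hl⟩ := LinearMap.exists_leftInverse_of_injective toC.toLinearMap
    (LinearMap.ker_eq_bot.2 hinj)
  have key : ContDiffAt ℝ ∞ (fun y => toC ((A y).compContinuousLinearMap (T y))) x := by
    have h1 : ContDiffAt ℝ ∞ (fun y => ContinuousMultilinearMap.compContinuousLinearMapContinuousMultilinear ℝ
        (fun _ : Fin k => E) (fun _ => E') V (fun _ => T y)) x := by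
      refine ContDiffAt.comp x (ContinuousMultilinearMap.contDiff _).contDiffAt ?_
      exact contDiffAt_pi.2 fun _ => hT
    have h2 : ContDiffAt ℝ ∞ (fun y => ContinuousAlternatingMap.toContinuousMultilinearMapCLM ℝ (A y)) x :=
      (ContinuousAlternatingMap.toContinuousMultilinearMapCLM (𝕜 := ℝ) (E := E') (F := V)
        (ι := Fin k) ℝ).contDiff.contDiffAt (n := ∞) |>.comp x hA
    exact h1.clm_apply h2
  have h3 := (l.toContinuousLinearMap.contDiff (n := ∞)).contDiffAt.comp x key
  refine h3.congr_of_eventuallyEq (Filter.Eventually.of_forall fun y => ?_)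
  exact (LinearMap.congr_fun hl _).symm


section Naturality

variable [IsManifold 𝓘(ℝ, E) ∞ P] [IsManifold 𝓘(ℝ, E') ∞ P']

theorem contMDiffAt_chart' {x p : P} (hp : p ∈ (chartAt E x).source) :
    ContMDiffAt 𝓘(ℝ, E) 𝓘(ℝ, E) ∞ (chartAt E x) p :=
  contMDiffAt_of_mem_maximalAtlas (IsManifold.chart_mem_maximalAtlas x) hp

theorem contMDiffAt_chart_symm' {x : P} {y : E} (hy : y ∈ (chartAt E x).target) :
    ContMDiffAt 𝓘(ℝ, E) 𝓘(ℝ, E) ∞ (chartAt E x).symm y :=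
  contMDiffAt_symm_of_mem_maximalAtlas (IsManifold.chart_mem_maximalAtlas x) hy

/-- The expression of `f` in the charts at `x` and `x'`. -/
def chartRep (f : P → P') (x : P) (x' : P') : E → E' :=
  fun y => chartAt E' x' (f ((chartAt E x).symm y))

theorem contDiffAt_chartRep {f : P → P'} {x : P} {x' : P'} {y : E} (hy : y ∈ (chartAt E x).target)
    (hf : ContMDiffAt 𝓘(ℝ, E) 𝓘(ℝ, E') ∞ f ((chartAt E x).symm y))
    (hy' : f ((chartAt E x).symm y) ∈ (chartAt E' x').source) :
    ContDiffAt ℝ ∞ (chartRep (E := E) (E' := E') f x x') y :=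
  contMDiffAt_iff_contDiffAt.1
    ((contMDiffAt_chart' hy').comp y (hf.comp y (contMDiffAt_chart_symm' hy)))

theorem fderiv_chartRep {f : P → P'} {x : P} {x' : P'} {y : E} (hy : y ∈ (chartAt E x).target)
    (hf : ContMDiffAt 𝓘(ℝ, E) 𝓘(ℝ, E') ∞ f ((chartAt E x).symm y))
    (hy' : f ((chartAt E x).symm y) ∈ (chartAt E' x').source) :
    fderiv ℝ (chartRep (E := E) (E' := E') f x x') y =
      ((tmap E' E' (chartAt E' x') (f ((chartAt E x).symm y))).comp
        (tmap E E' f ((chartAt E x).symm y))).comp (tmap E E (chartAt E x).symm y) := by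
  have h0 : (∞ : WithTop ℕ∞) ≠ 0 := by simp
  have h1 := (contMDiffAt_chart_symm' (P := P) hy).mdifferentiableAt h0
  have h2 := hf.mdifferentiableAt h0
  have h3 := (contMDiffAt_chart' (P := P') hy').mdifferentiableAt h0
  rw [← tmap_eq_fderiv, ← tmap_comp (P'' := E') h3 h2]
  exact tmap_comp (P := E) (P' := P) (P'' := E') (g := fun q => chartAt E' x' (f q)) (h3.comp _ h2) h1

theorem tmap_chart_symm_comp {x p : P} (hp : p ∈ (chartAt E x).source) :
    (tmap E E (chartAt E x).symm (chartAt E x p)).comp (tmap E E (chartAt E x) p) =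
      ContinuousLinearMap.id ℝ E := by
  have h0 : (∞ : WithTop ℕ∞) ≠ 0 := by simp
  rw [← tmap_comp (P' := E)
    ((contMDiffAt_chart_symm' ((chartAt E x).map_source hp)).mdifferentiableAt h0)
    ((contMDiffAt_chart' hp).mdifferentiableAt h0), ← tmap_id p]
  refine tmap_congr ?_
  filter_upwards [(chartAt E x).open_source.mem_nhds hp] with q hq
  exact (chartAt E x).left_inv hq

theorem tmap_chart_comp_symm {x : P} {y : E} (hy : y ∈ (chartAt E x).target) :
    (tmap E E (chartAt E x) ((chartAt E x).symm y)).comp (tmap E E (chartAt E x).symm y) =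
      ContinuousLinearMap.id ℝ E := by
  have h0 : (∞ : WithTop ℕ∞) ≠ 0 := by simp
  rw [← tmap_comp (P := E) (P'' := E)
    ((contMDiffAt_chart' ((chartAt E x).map_target hy)).mdifferentiableAt h0)
    ((contMDiffAt_chart_symm' hy).mdifferentiableAt h0), ← tmap_id (P := E) y]
  refine tmap_congr ?_
  filter_upwards [(chartAt E x).open_target.mem_nhds hy] with q hq
  exact (chartAt E x).right_inv hq

namespace RawForm

variable {k : ℕ}

theorem rep_pullback {f : P → P'} {α : RawForm E' P' V k} {x : P} {x' : P'} {y : E}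
    (hy : y ∈ (chartAt E x).target)
    (hf : ContMDiffAt 𝓘(ℝ, E) 𝓘(ℝ, E') ∞ f ((chartAt E x).symm y))
    (hy' : f ((chartAt E x).symm y) ∈ (chartAt E' x').source) :
    (pullback (E := E) f α).rep (chartAt E x) y =
      (α.rep (chartAt E' x') (chartRep (E := E) (E' := E') f x x' y)).compContinuousLinearMap
        (fderiv ℝ (chartRep (E := E) (E' := E') f x x') y) := by
  have hl : (chartAt E' x').symm (chartRep (E := E) (E' := E') f x x' y) =
    f ((chartAt E x).symm y) := (chartAt E' x').left_inv hy'
  have hc := tmap_chart_symm_comp hy'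
  rw [fderiv_chartRep hy hf hy']
  unfold rep pullback
  rw [hl]
  ext v
  simp only [ContinuousAlternatingMap.compContinuousLinearMap_apply]
  congr 1
  ext i
  exact (DFunLike.congr_fun hc _).symm

theorem eventually_chart {f : P → P'} {x : P} {x' : P'} {y : E}
    (hy : y ∈ (chartAt E x).target) (hf : ContMDiff 𝓘(ℝ, E) 𝓘(ℝ, E') ∞ f)
    (hy' : f ((chartAt E x).symm y) ∈ (chartAt E' x').source) :
    ∀ᶠ z in 𝓝 y, z ∈ (chartAt E x).target ∧ f ((chartAt E x).symm z) ∈ (chartAt E' x').source := by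
  refine Filter.Eventually.and ((chartAt E x).open_target.mem_nhds hy) ?_
  exact (hf.continuous.continuousAt.comp ((chartAt E x).continuousAt_symm hy)).eventually
    ((chartAt E' x').open_source.mem_nhds hy')

theorem IsSmooth.contDiffAt {α : RawForm E P V k} (h : α.IsSmooth) {x : P} {y : E}
    (hy : y ∈ (chartAt E x).target) : ContDiffAt ℝ ∞ (α.rep (chartAt E x)) y :=
  (h x).contDiffAt ((chartAt E x).open_target.mem_nhds hy)

theorem isSmooth_of_contDiffAt {α : RawForm E P V k}
    (h : ∀ (x : P), ∀ y ∈ (chartAt E x).target, ContDiffAt ℝ ∞ (α.rep (chartAt E x)) y) :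
    α.IsSmooth := fun x y hy => (h x y hy).contDiffWithinAt

theorem IsSmooth.pullback [FiniteDimensional ℝ E] [FiniteDimensional ℝ E'] [FiniteDimensional ℝ V]
    {f : P → P'} {α : RawForm E' P' V k} (h : α.IsSmooth) (hf : ContMDiff 𝓘(ℝ, E) 𝓘(ℝ, E') ∞ f) :
    (α.pullback (E := E) f).IsSmooth := by
  refine isSmooth_of_contDiffAt fun x y hy => ?_
  set x' := f ((chartAt E x).symm y)
  have hy' : f ((chartAt E x).symm y) ∈ (chartAt E' x').source := mem_chart_source E' x'
  have hr := contDiffAt_chartRep hy hf.contMDiffAt hy'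
  have h1 := (h.contDiffAt ((chartAt E' x').map_source hy')).comp y hr
  refine (contDiffAt_compAlt h1 (hr.fderiv_right (m := ∞) (by simp))).congr_of_eventuallyEq ?_
  filter_upwards [eventually_chart hy hf hy'] with z hz
  exact rep_pullback hz.1 hf.contMDiffAt hz.2

/-- The exterior derivative commutes with pullbacks, in charts. -/
theorem extDeriv_rep_pullback {f : P → P'} {α : RawForm E' P' V k} (h : α.IsSmooth)
    (hf : ContMDiff 𝓘(ℝ, E) 𝓘(ℝ, E') ∞ f) {x : P} {x' : P'} {y : E}
    (hy : y ∈ (chartAt E x).target)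
    (hy' : f ((chartAt E x).symm y) ∈ (chartAt E' x').source) :
    extDeriv ((pullback (E := E) f α).rep (chartAt E x)) y =
      (extDeriv (α.rep (chartAt E' x'))
        (chartAt E' x' (f ((chartAt E x).symm y)))).compContinuousLinearMap
        (((tmap E' E' (chartAt E' x') (f ((chartAt E x).symm y))).comp
        (tmap E E' f ((chartAt E x).symm y))).comp (tmap E E (chartAt E x).symm y)) := by
  rw [← fderiv_chartRep hy hf.contMDiffAt hy']
  have hr := contDiffAt_chartRep hy hf.contMDiffAt hy'
  have h1 := (h.contDiffAt ((chartAt E' x').map_source hy')).differentiableAt (by simp)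
  have h2 := extDeriv_pullback (f := chartRep (E := E) (E' := E') f x x') (x := y) h1 hr
    (by rw [minSmoothness_of_isRCLikeNormedField]; exact WithTop.coe_le_coe.2 le_top)
  refine Eq.trans (Filter.EventuallyEq.extDeriv_eq ?_) h2
  filter_upwards [eventually_chart hy hf hy'] with z hz
  exact rep_pullback hz.1 hf.contMDiffAt hz.2

theorem pullback_id (α : RawForm E P V k) : α.pullback (E := E) (fun q : P => q) = α := by
  funext p
  simp only [pullback, tmap_id]
  ext v
  rfl

/-- The exterior derivative does not depend on the chart. -/
theorem rep_extD {α : RawForm E P V k} (h : α.IsSmooth) {x : P} {y : E}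
    (hy : y ∈ (chartAt E x).target) :
    α.extD.rep (chartAt E x) y = extDeriv (α.rep (chartAt E x)) y := by
  have := extDeriv_rep_pullback (f := fun q : P => q) h contMDiff_id
    (x' := (chartAt E x).symm y) hy (mem_chart_source E _)
  rw [pullback_id, tmap_id] at this
  rw [this]
  rfl

theorem extD_pullback {f : P → P'} {α : RawForm E' P' V k} (h : α.IsSmooth)
    (hf : ContMDiff 𝓘(ℝ, E) 𝓘(ℝ, E') ∞ f) :
    (α.pullback (E := E) f).extD = α.extD.pullback (E := E) f := by
  funext p
  have hp := mem_chart_source E p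
  have hl : (chartAt E p).symm (chartAt E p p) = p := (chartAt E p).left_inv hp
  have := extDeriv_rep_pullback h hf (x := p) (x' := f p) (y := chartAt E p p)
    ((chartAt E p).map_source hp) (by rw [hl]; exact mem_chart_source E' _)
  rw [extD, this, hl, pullback, extD]
  ext v
  simp only [ContinuousAlternatingMap.compContinuousLinearMap_apply]
  congr 1
  ext i
  exact congrArg (fun z => tmap E' E' (chartAt E' (f p)) (f p) (tmap E E' f p z))
    (DFunLike.congr_fun (tmap_chart_symm_comp hp) (v i))

theorem IsSmooth.extD {α : RawForm E P V k} (h : α.IsSmooth) : α.extD.IsSmooth := by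
  refine isSmooth_of_contDiffAt fun x y hy => ?_
  have h1 : ContDiffAt ℝ ∞ (fun z => extDeriv (α.rep (chartAt E x)) z) y := by
    exact (ContinuousAlternatingMap.alternatizeUncurryFinCLM ℝ E V (n := k)).contDiff.contDiffAt (n := ∞).comp y
      ((h.contDiffAt hy).fderiv_right (m := ∞) (by simp))
  refine h1.congr_of_eventuallyEq ?_
  filter_upwards [(chartAt E x).open_target.mem_nhds hy] with z hz
  exact rep_extD h hz

theorem pullback_pullback {f : P → P'} {g : P' → P''} {α : RawForm E'' P'' V k}
    (hf : MDifferentiable 𝓘(ℝ, E) 𝓘(ℝ, E') f) (hg : MDifferentiable 𝓘(ℝ, E') 𝓘(ℝ, E'') g) :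
    (α.pullback (E := E') g).pullback (E := E) f = α.pullback (E := E) (fun p => g (f p)) := by
  funext p
  simp only [pullback]
  rw [tmap_comp (hg _) (hf _)]
  rfl

/-- A linear map applied to the values of a form. -/
def mapVal (L : V →L[ℝ] V) (α : RawForm E P V k) : RawForm E P V k :=
  fun p => L.compContinuousAlternatingMap (α p)

theorem extD_mapVal {α : RawForm E P V k} (h : α.IsSmooth) (L : V →L[ℝ] V) :
    (α.mapVal L).extD = α.extD.mapVal L := by
  funext p
  have hp := (chartAt E p).map_source (mem_chart_source E p)
  have hd := (h.contDiffAt hp).differentiableAt (by simp)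
  let T : (E [⋀^Fin k]→L[ℝ] V) →L[ℝ] (E [⋀^Fin k]→L[ℝ] V) :=
    ContinuousLinearMap.compContinuousAlternatingMapCLM ℝ E V V (Fin k) L
  have h1 : (α.mapVal L).rep (chartAt E p) = fun y => T (α.rep (chartAt E p) y) := rfl
  have h2 : fderiv ℝ (fun y => T (α.rep (chartAt E p) y)) (chartAt E p p) =
    T.comp (fderiv ℝ (α.rep (chartAt E p)) (chartAt E p p)) :=
    (T.hasFDerivAt.comp _ hd.hasFDerivAt).fderiv
  ext v
  simp only [extD, h1, mapVal, extDeriv, h2, ContinuousAlternatingMap.compContinuousLinearMap_apply,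
    ContinuousLinearMap.compContinuousAlternatingMap_coe, Function.comp_apply,
    ContinuousAlternatingMap.alternatizeUncurryFin_apply, map_sum, map_zsmul]
  simp [T]

end RawForm

end Naturality

end Forms

section Bundles

variable {n : ℕ} {EG : Type*} [NormedAddCommGroup EG] [NormedSpace ℝ EG] [FiniteDimensional ℝ EG]
  {G : Type*} [TopologicalSpace G] [ChartedSpace EG G] [Group G] [LieGroup 𝓘(ℝ, EG) ∞ G]
  {E : Type*} [NormedAddCommGroup E] [NormedSpace ℝ E] [FiniteDimensional ℝ E]
  {P : Type*} [TopologicalSpace P] [ChartedSpace E P] [IsManifold 𝓘(ℝ, E) ∞ P]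
  {M : Type*} [TopologicalSpace M] [ChartedSpace (EuclideanSpace ℝ (Fin n)) M]

variable (EG) in
/-- The adjoint action of `g` on the Lie algebra `T_1 G = EG`. -/
def Ad (g : G) : EG →L[ℝ] EG := tmap EG EG (fun h : G => g * h * g⁻¹) 1

variable (n EG G E P M) in
/-- A smooth principal `G`-bundle `P → M`: a smooth right action of `G` on `P` over `M` which is
locally trivial, i.e. near every point of `M` there are a smooth section `s` and a smooth map `ψ` such
that `(y, g) ↦ s y · g` is a diffeomorphism onto the preimage with inverse `p ↦ (π p, ψ p)`. -/
structure PrincipalBundle where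
  /-- the bundle projection -/
  proj : P → M
  /-- the right action of the structure group -/
  act : P → G → P
  act_one : ∀ p, act p 1 = p
  act_mul : ∀ p g h, act p (g * h) = act (act p g) h
  proj_act : ∀ p g, proj (act p g) = proj p
  contMDiff_proj : ContMDiff 𝓘(ℝ, E) (𝓡 n) ∞ proj
  contMDiff_act : ContMDiff (𝓘(ℝ, E).prod 𝓘(ℝ, EG)) 𝓘(ℝ, E) ∞ (fun q : P × G => act q.1 q.2)
  locally_trivial : ∀ x : M, ∃ (U : Set M) (s : M → P) (ψ : P → G), IsOpen U ∧ x ∈ U ∧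
    ContMDiffOn (𝓡 n) 𝓘(ℝ, E) ∞ s U ∧ ContMDiffOn 𝓘(ℝ, E) 𝓘(ℝ, EG) ∞ ψ (proj ⁻¹' U) ∧
    (∀ y ∈ U, proj (s y) = y) ∧ (∀ p ∈ proj ⁻¹' U, act (s (proj p)) (ψ p) = p) ∧
    ∀ y ∈ U, ∀ g, ψ (act (s y) g) = g

namespace PrincipalBundle

variable (B : PrincipalBundle n EG G E P M)

theorem contMDiff_act_right (g : G) : ContMDiff 𝓘(ℝ, E) 𝓘(ℝ, E) ∞ (fun p => B.act p g) :=
  B.contMDiff_act.comp (contMDiff_id.prodMk contMDiff_const)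

theorem contMDiff_act_left (p : P) : ContMDiff 𝓘(ℝ, EG) 𝓘(ℝ, E) ∞ (fun g => B.act p g) :=
  B.contMDiff_act.comp (contMDiff_const.prodMk contMDiff_id)

/-- The value at `p` of the fundamental vector field of `A`, the velocity of a curve `p · g(t)` with
`g(0) = 1` and `g'(0) = A`. These vectors are the vertical vectors at `p`. -/
def fund (p : P) : EG →L[ℝ] E := tmap EG E (fun g => B.act p g) 1

theorem tmap_act_fund (p : P) (g : G) :
    (tmap E E (fun q => B.act q g) p).comp (B.fund p) = (B.fund (B.act p g)).comp (Ad EG g⁻¹) := by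
  have h0 : (∞ : WithTop ℕ∞) ≠ 0 := by simp
  have hA : ContMDiff 𝓘(ℝ, EG) 𝓘(ℝ, EG) ∞ (fun h : G => g⁻¹ * h * g⁻¹⁻¹) :=
    (contMDiff_const.mul contMDiff_id).mul contMDiff_const
  have h1 : tmap EG E (fun h : G => B.act (B.act p h) g) 1 =
      (tmap E E (fun q => B.act q g) (B.act p 1)).comp (B.fund p) :=
    tmap_comp (g := fun q => B.act q g) ((B.contMDiff_act_right g).mdifferentiable h0 _)
      ((B.contMDiff_act_left p).mdifferentiable h0 _)
  have h2 : tmap EG E (fun h : G => B.act (B.act p g) (g⁻¹ * h * g⁻¹⁻¹)) 1 =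
      (tmap EG E (fun h => B.act (B.act p g) h) (g⁻¹ * 1 * g⁻¹⁻¹)).comp (Ad EG g⁻¹) :=
    tmap_comp (g := fun h => B.act (B.act p g) h)
      ((B.contMDiff_act_left (B.act p g)).mdifferentiable h0 _) (hA.mdifferentiable h0 _)
  have h3 : (fun h : G => B.act (B.act p g) (g⁻¹ * h * g⁻¹⁻¹)) = fun h => B.act (B.act p h) g := by
    funext h
    rw [← B.act_mul, ← B.act_mul]
    congr 1
    group
  rw [h3, h1, B.act_one] at h2
  rw [h2]
  simp [fund]

/-- Equivariant forms: `R_g^* α = Ad(g⁻¹) α`. -/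
def IsEquivariant {k : ℕ} (α : RawForm E P EG k) : Prop :=
  ∀ g : G, α.pullback (E := E) (fun p => B.act p g) = α.mapVal (Ad EG g⁻¹)

/-- Horizontal forms: they vanish as soon as one argument is vertical. -/
def IsHorizontal {k : ℕ} (α : RawForm E P EG k) : Prop :=
  ∀ (p : P) (v : Fin k → E), (∃ i, v i ∈ Set.range (B.fund p)) → α p v = 0

/-- Connection 1-forms: smooth equivariant forms which reproduce the generators of the fundamental
vector fields. -/
structure IsConnection (D : RawForm E P EG 1) : Prop where
  smooth : D.IsSmooth
  equivariant : B.IsEquivariant D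
  vertical : ∀ (p : P) (A : EG), D p ![B.fund p A] = A

/-- The projection `X ↦ X - D(X)^*` onto the horizontal subspace `ker D_p`. -/
def hor (D : RawForm E P EG 1) (p : P) : E →L[ℝ] E :=
  ContinuousLinearMap.id ℝ E -
    (B.fund p).comp ((ContinuousAlternatingMap.ofSubsingleton ℝ E EG (0 : Fin 1)).symm (D p))

/-- The exterior covariant derivative `d_D α`, the horizontal part of `dα`. -/
def covD {k : ℕ} (D : RawForm E P EG 1) (α : RawForm E P EG k) : RawForm E P EG (k + 1) :=
  fun p => (α.extD p).compContinuousLinearMap (B.hor D p)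

theorem hor_apply (D : RawForm E P EG 1) (p : P) (X : E) :
    B.hor D p X = X - B.fund p (D p ![X]) := by
  have h : (ContinuousAlternatingMap.ofSubsingleton ℝ E EG (0 : Fin 1)).symm (D p) X = D p ![X] := by
    refine congrArg (D p) ?_
    ext i
    fin_cases i
    rfl
  rw [← h]
  rfl

variable {B}

theorem IsConnection.hor_fund {D : RawForm E P EG 1} (h : B.IsConnection D) (p : P) (A : EG) :
    B.hor D p (B.fund p A) = 0 := by
  rw [hor_apply, h.vertical, sub_self]

theorem IsConnection.isHorizontal_covD {k : ℕ} {D : RawForm E P EG 1} (h : B.IsConnection D)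
    (α : RawForm E P EG k) : B.IsHorizontal (B.covD D α) := by
  rintro p v ⟨i, A, hA⟩
  have h1 : B.hor D p (v i) = 0 := by rw [← hA, h.hor_fund]
  exact (α.extD p).map_coord_zero (m := fun j => B.hor D p (v j)) i h1

theorem IsConnection.tmap_act_hor {D : RawForm E P EG 1} (h : B.IsConnection D) (p : P) (g : G)
    (X : E) : B.hor D (B.act p g) (tmap E E (fun q => B.act q g) p X) =
      tmap E E (fun q => B.act q g) p (B.hor D p X) := by
  have h1 : D (B.act p g) ![tmap E E (fun q => B.act q g) p X] = Ad EG g⁻¹ (D p ![X]) := by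
    have := congrArg (fun β => β ![X]) (congrFun (h.equivariant g) p)
    refine Eq.trans ?_ this
    simp only [RawForm.pullback, ContinuousAlternatingMap.compContinuousLinearMap_apply]
    congr 1
    ext i
    fin_cases i
    rfl
  rw [hor_apply, hor_apply, h1, map_sub]
  congr 1
  exact (DFunLike.congr_fun (B.tmap_act_fund p g) _).symm

theorem IsConnection.isEquivariant_covD {k : ℕ} {D : RawForm E P EG 1} (h : B.IsConnection D)
    {α : RawForm E P EG k} (hα : α.IsSmooth) (hα' : B.IsEquivariant α) :
    B.IsEquivariant (B.covD D α) := by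
  intro g
  have h1 := RawForm.extD_pullback hα (B.contMDiff_act_right g)
  rw [hα' g, RawForm.extD_mapVal hα] at h1
  funext p
  ext v
  have h2 := congrArg (fun β => β (fun i => B.hor D p (v i))) (congrFun h1 p)
  refine Eq.trans ?_ h2.symm
  simp only [RawForm.pullback, covD, ContinuousAlternatingMap.compContinuousLinearMap_apply]
  congr 1
  ext i
  exact h.tmap_act_hor p g (v i)

theorem IsConnection.isSmooth_covD {k : ℕ} {D : RawForm E P EG 1} (h : B.IsConnection D)
    {α : RawForm E P EG k} (hα : α.IsSmooth) : (B.covD D α).IsSmooth := by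
  refine RawForm.isSmooth_of_contDiffAt fun x y hy => ?_
  have h0 : (∞ : WithTop ℕ∞) ≠ 0 := by simp
  let Φ : E → EG → E := fun u z => chartAt E x (B.act ((chartAt E x).symm u) ((chartAt EG (1 : G)).symm z))
  let z0 : EG := chartAt EG (1 : G) 1
  have hz0 : z0 ∈ (chartAt EG (1 : G)).target := (chartAt EG (1 : G)).map_source (mem_chart_source EG _)
  have hs : (chartAt EG (1 : G)).symm z0 = 1 := (chartAt EG (1 : G)).left_inv (mem_chart_source EG _)
  have hΦ : ContDiffAt ℝ ∞ (Function.uncurry Φ) (y, z0) := by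
    have hq : (B.act ((chartAt E x).symm y) ((chartAt EG (1 : G)).symm z0)) ∈ (chartAt E x).source := by
      rw [hs, B.act_one]
      exact (chartAt E x).map_target hy
    have key : ContMDiffAt (𝓘(ℝ, E).prod 𝓘(ℝ, EG)) 𝓘(ℝ, E) ∞ (Function.uncurry Φ) (y, z0) := by
      have hB := B.contMDiff_act.contMDiffAt (x := ((chartAt E x).symm y, (chartAt EG (1 : G)).symm z0))
      refine ContMDiffAt.comp (I' := 𝓘(ℝ, E)) (y, z0) (contMDiffAt_chart' hq) ?_
      refine ContMDiffAt.comp (I' := 𝓘(ℝ, E).prod 𝓘(ℝ, EG)) (f := fun q : E × EG =>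
        ((chartAt E x).symm q.1, (chartAt EG (1 : G)).symm q.2)) (y, z0) hB ?_
      refine ContMDiffAt.prodMk ?_ ?_
      · exact (contMDiffAt_chart_symm' (P := P) (x := x) (y := y) hy).comp (y, z0) contMDiffAt_fst
      · exact (contMDiffAt_chart_symm' (P := G) (x := 1) (y := z0) hz0).comp (y, z0) contMDiffAt_snd
    rw [← contMDiffAt_iff_contDiffAt, modelWithCornersSelf_prod, ← chartedSpaceSelf_prod]
    exact key
  have hK : ContDiffAt ℝ ∞ (fun u => fderiv ℝ (Φ u) z0) y :=
    ContDiffAt.fderiv (n := ∞) hΦ contDiffAt_const (by simp)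
  let L : (E [⋀^Fin 1]→L[ℝ] EG) →L[ℝ] (E →L[ℝ] EG) :=
    ((ContinuousAlternatingMap.ofSubsingletonLIE (𝕜 := ℝ) (E := E) (F := EG) (0 : Fin 1)).symm.toContinuousLinearEquiv :
      (E [⋀^Fin 1]→L[ℝ] EG) →L[ℝ] (E →L[ℝ] EG))
  let H : E → E →L[ℝ] E := fun u => ContinuousLinearMap.id ℝ E -
    ((fderiv ℝ (Φ u) z0).comp (tmap EG EG (chartAt EG (1 : G)) 1)).comp (L (D.rep (chartAt E x) u))
  have hH : ContDiffAt ℝ ∞ H y := by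
    refine contDiffAt_const.sub (ContDiffAt.clm_comp (hK.clm_comp contDiffAt_const) ?_)
    exact L.contDiff.contDiffAt.comp y (h.smooth.contDiffAt hy)
  refine (contDiffAt_compAlt (hα.extD.contDiffAt hy) hH).congr_of_eventuallyEq ?_
  filter_upwards [(chartAt E x).open_target.mem_nhds hy] with u hu
  set q := (chartAt E x).symm u with hqdef
  have hqs : q ∈ (chartAt E x).source := (chartAt E x).map_target hu
  have hf := fderiv_chartRep (f := fun g => B.act q g) (x := (1 : G)) (x' := x) hz0
    (B.contMDiff_act_left q).contMDiffAt (by rw [hs, B.act_one]; exact hqs)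
  have hf' : fderiv ℝ (Φ u) z0 = ((tmap E E (chartAt E x) q).comp (B.fund q)).comp
      (tmap EG EG (chartAt EG (1 : G)).symm z0) := by
    refine hf.trans ?_
    simp only [hs, B.act_one]
    rfl
  have hc1 := tmap_chart_symm_comp (E := EG) (mem_chart_source EG (1 : G))
  have hc2 := tmap_chart_symm_comp (E := E) hqs
  have hcu : chartAt E x q = u := (chartAt E x).right_inv hu
  have hc3 := tmap_chart_comp_symm (E := E) (P := P) (x := x) hu
  have hHX : ∀ X : E, tmap E E (chartAt E x).symm u (H u X) =
      B.hor D q (tmap E E (chartAt E x).symm u X) := by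
    intro X
    have hL : L (D.rep (chartAt E x) u) X = D q ![tmap E E (chartAt E x).symm u X] := by
      refine congrArg (D q) ?_
      ext i
      fin_cases i
      rfl
    have e1 : H u X = X - fderiv ℝ (Φ u) z0 (tmap EG EG (chartAt EG (1 : G)) 1
        (L (D.rep (chartAt E x) u) X)) := rfl
    have e2 : ∀ A, tmap EG EG (chartAt EG (1 : G)).symm z0 (tmap EG EG (chartAt EG (1 : G)) 1 A) = A :=
      fun A => DFunLike.congr_fun hc1 A
    have e3 : ∀ W, tmap E E (chartAt E x).symm u (tmap E E (chartAt E x) q W) = W := fun W => by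
      have := DFunLike.congr_fun hc2 W
      rw [hcu] at this
      exact this
    rw [hor_apply, e1, hL, hf', map_sub]
    simp only [ContinuousLinearMap.comp_apply]
    rw [e2, e3]
  ext v
  simp only [RawForm.rep, covD, ContinuousAlternatingMap.compContinuousLinearMap_apply]
  congr 1
  ext i
  exact (hHX (v i)).symm

/-- `B.OmegaHE k` is the space of smooth horizontal equivariant `k`-forms with values in the
Lie algebra. -/
def OmegaHE (B : PrincipalBundle n EG G E P M) (k : ℕ) : Submodule ℝ (RawForm E P EG k) where
  carrier := {α | α.IsSmooth ∧ B.IsEquivariant α ∧ B.IsHorizontal α}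
  zero_mem' := by
    refine ⟨fun x => (contDiffOn_const (c := 0)).congr fun y _ => rfl, fun g => ?_, fun p v _ => rfl⟩
    funext p
    ext v
    exact (map_zero (Ad EG g⁻¹)).symm
  add_mem' := by
    rintro α β ⟨h1, h2, h3⟩ ⟨h1', h2', h3'⟩
    refine ⟨fun x => ((h1 x).add (h1' x)).congr fun y _ => rfl, fun g => ?_, fun p v hv => ?_⟩
    · have := congrArg₂ (· + ·) (h2 g) (h2' g)
      refine Eq.trans this ?_
      funext p
      ext v
      exact (map_add (Ad EG g⁻¹) _ _).symm
    · exact (congrArg₂ (· + ·) (h3 p v hv) (h3' p v hv)).trans (add_zero 0)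
  smul_mem' := by
    rintro c α ⟨h1, h2, h3⟩
    refine ⟨fun x => ((h1 x).const_smul c).congr fun y _ => rfl, fun g => ?_, fun p v hv => ?_⟩
    · refine Eq.trans (congrArg (c • ·) (h2 g)) ?_
      funext p
      ext v
      exact (map_smul (Ad EG g⁻¹) c _).symm
    · exact (congrArg (c • ·) (h3 p v hv)).trans (smul_zero c)

variable (B)

/-- The group of global gauge transformations: the automorphisms of the principal bundle, i.e.
the equivariant diffeomorphisms of the total space over the identity of the base. -/
def gauge : Subgroup (Equiv.Perm P) where
  carrier := {f | ContMDiff 𝓘(ℝ, E) 𝓘(ℝ, E) ∞ f ∧ ContMDiff 𝓘(ℝ, E) 𝓘(ℝ, E) ∞ f.symm ∧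
    (∀ p g, f (B.act p g) = B.act (f p) g) ∧ ∀ p, B.proj (f p) = B.proj p}
  one_mem' := ⟨contMDiff_id, contMDiff_id, fun _ _ => rfl, fun _ => rfl⟩
  mul_mem' := by
    rintro f f' ⟨h1, h2, h3, h4⟩ ⟨h1', h2', h3', h4'⟩
    refine ⟨h1.comp h1', h2'.comp h2, fun p g => ?_, fun p => ?_⟩
    · simp only [Equiv.Perm.coe_mul, Function.comp_apply, h3', h3]
    · simp only [Equiv.Perm.coe_mul, Function.comp_apply, h4', h4]
  inv_mem' := by
    rintro f ⟨h1, h2, h3, h4⟩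
    refine ⟨h2, h1, fun p g => ?_, fun p => ?_⟩
    · refine f.injective ?_
      rw [h3]
      simp
    · rw [← h4]
      simp

theorem gauge_contMDiff (f : B.gauge) : ContMDiff 𝓘(ℝ, E) 𝓘(ℝ, E) ∞ (f : Equiv.Perm P) := f.2.1

end PrincipalBundle

variable (E P) in
/-- The smooth `V`-valued `k`-forms on `P`. -/
abbrev SmoothForm (V : Type*) [NormedAddCommGroup V] [NormedSpace ℝ V] (k : ℕ) : Type _ :=
  {α : RawForm E P V k // α.IsSmooth}

namespace PrincipalBundle

variable (B : PrincipalBundle n EG G E P M)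

/-- Gauge transformations act on 1-forms by pullback; the inverse makes this a left action and does
not change the orbits. -/
instance gaugeAction : MulAction B.gauge (SmoothForm E P EG 1) where
  smul f α := ⟨α.1.pullback (E := E) ((f⁻¹ : B.gauge) : Equiv.Perm P),
    α.2.pullback (B.gauge_contMDiff f⁻¹)⟩
  one_smul α := Subtype.ext (RawForm.pullback_id α.1)
  mul_smul f f' α := by
    have h0 : (∞ : WithTop ℕ∞) ≠ 0 := by simp
    refine Subtype.ext ?_
    refine Eq.trans ?_ (RawForm.pullback_pullback (α := α.1)
      ((B.gauge_contMDiff f⁻¹).mdifferentiable h0) ((B.gauge_contMDiff f'⁻¹).mdifferentiable h0)).symm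
    change α.1.pullback (E := E) (((f * f')⁻¹ : B.gauge) : Equiv.Perm P) = _
    rw [mul_inv_rev]
    rfl

theorem gauge_smul_coe (f : B.gauge) (α : SmoothForm E P EG 1) :
    (f • α).1 = α.1.pullback (E := E) ((f⁻¹ : B.gauge) : Equiv.Perm P) := rfl

/-- The set of connection 1-forms. -/
def Conn : Set (SmoothForm E P EG 1) := {D | B.IsConnection D.1}

/-- The set of equivariant 1-forms. -/
def equivariantForms : Set (SmoothForm E P EG 1) := {α | B.IsEquivariant α.1}

theorem conn_subset_equivariantForms : B.Conn ⊆ B.equivariantForms := fun _ h => h.equivariant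

theorem gauge_smul_mem_conn (f : B.gauge) {D : SmoothForm E P EG 1} (hD : D ∈ B.Conn) :
    f • D ∈ B.Conn := by
  have h0 : (∞ : WithTop ℕ∞) ≠ 0 := by simp
  have hf := (B.gauge_contMDiff f⁻¹)
  have hfa : ∀ p g, ((f⁻¹ : B.gauge) : Equiv.Perm P) (B.act p g) =
    B.act (((f⁻¹ : B.gauge) : Equiv.Perm P) p) g := (f⁻¹).2.2.2.1
  set φ : P → P := fun p => ((f⁻¹ : B.gauge) : Equiv.Perm P) p with hφ
  refine ⟨(f • D).2, fun g => ?_, fun p A => ?_⟩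
  · rw [gauge_smul_coe, RawForm.pullback_pullback ((B.contMDiff_act_right g).mdifferentiable h0)
      (hf.mdifferentiable h0)]
    have h1 : (fun p => φ (B.act p g)) = fun p => B.act (φ p) g := funext fun p => hfa p g
    have h2 := RawForm.pullback_pullback (α := D.1) (f := φ) (g := fun p => B.act p g)
      (hf.mdifferentiable h0) ((B.contMDiff_act_right g).mdifferentiable h0)
    rw [h1, ← h2, hD.equivariant g]
    rfl
  · have h1 : tmap EG E (fun g => φ (B.act p g)) 1 = (tmap E E φ (B.act p 1)).comp (B.fund p) :=
      tmap_comp (g := φ) (hf.mdifferentiable h0 _) ((B.contMDiff_act_left p).mdifferentiable h0 _)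
    have h2 : (fun g => φ (B.act p g)) = fun g => B.act (φ p) g := funext fun g => hfa p g
    rw [h2, B.act_one] at h1
    have h3 := hD.vertical (φ p) A
    have h4 : B.fund (φ p) A = tmap E E φ p (B.fund p A) := DFunLike.congr_fun h1 A
    rw [h4] at h3
    refine Eq.trans ?_ h3
    refine congrArg (D.1 (φ p)) ?_
    ext i
    fin_cases i
    rfl

/-- The field strength `F_D = d_D D` of a connection. -/
def fieldStrength (D : B.Conn) : B.OmegaHE 2 :=
  ⟨B.covD D.1.1 D.1.1, D.2.isSmooth_covD D.1.2, D.2.isEquivariant_covD D.1.2 D.2.equivariant,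
    D.2.isHorizontal_covD D.1.1⟩

end PrincipalBundle

end Bundles

section Densities

variable (n : ℕ) (M : Type*) [TopologicalSpace M] [ChartedSpace (EuclideanSpace ℝ (Fin n)) M]

/-- The expression of a density `μ` in a chart, `μ (∂₁, …, ∂ₙ)`. -/
def densityRep {n : ℕ} {M : Type*} [TopologicalSpace M] [ChartedSpace (EuclideanSpace ℝ (Fin n)) M]
    (μ : M → (Fin n → EuclideanSpace ℝ (Fin n)) → ℝ)
    (c : OpenPartialHomeomorph M (EuclideanSpace ℝ (Fin n))) (y : EuclideanSpace ℝ (Fin n)) : ℝ :=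
  μ (c.symm y) fun i => tmap (EuclideanSpace ℝ (Fin n)) (EuclideanSpace ℝ (Fin n)) c.symm y
    (EuclideanSpace.single i 1)

/-- The space of smooth 1-densities: at each point a function of `n` tangent vectors which scales by
`|det A|` under a linear map `A`. -/
def Dens : Submodule ℝ (M → (Fin n → EuclideanSpace ℝ (Fin n)) → ℝ) where
  carrier := {μ |
    (∀ (x : M) (A : EuclideanSpace ℝ (Fin n) →ₗ[ℝ] EuclideanSpace ℝ (Fin n))
      (v : Fin n → EuclideanSpace ℝ (Fin n)), μ x (fun i => A (v i)) = |LinearMap.det A| * μ x v) ∧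
    ∀ x : M, ContDiffOn ℝ ∞ (densityRep μ (chartAt (EuclideanSpace ℝ (Fin n)) x))
      (chartAt (EuclideanSpace ℝ (Fin n)) x).target}
  zero_mem' := ⟨fun _ _ _ => (mul_zero _).symm, fun _ => contDiffOn_const⟩
  add_mem' := by
    rintro μ ν ⟨h1, h2⟩ ⟨h1', h2'⟩
    refine ⟨fun x A v => ?_, fun x => (h2 x).add (h2' x)⟩
    simp only [Pi.add_apply, h1, h1', mul_add]
  smul_mem' := by
    rintro c μ ⟨h1, h2⟩
    refine ⟨fun x A v => ?_, fun x => contDiffOn_const.mul (h2 x)⟩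
    simp only [Pi.smul_apply, smul_eq_mul, h1]
    ring

variable {n M}
variable [IsManifold (𝓡 n) ∞ M] [T2Space M] [SigmaCompactSpace M]

variable (n M) in
/-- A partition of unity subordinate to the charts. -/
def chartPartition : SmoothPartitionOfUnity M (𝓡 n) M Set.univ :=
  Classical.choose (SmoothPartitionOfUnity.exists_isSubordinate_chartAt_source (𝓡 n) M)

/-- The part of a density supported in the `i`-th chart, expressed in that chart. -/
def localPart (μ : Dens n M) (i : M) (y : EuclideanSpace ℝ (Fin n)) : ℝ :=
  chartPartition n M i ((chartAt (EuclideanSpace ℝ (Fin n)) i).symm y) *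
    densityRep μ.1 (chartAt (EuclideanSpace ℝ (Fin n)) i) y

/-- A density is integrable if the integral of its absolute value is finite. -/
structure DensityIntegrable (μ : Dens n M) : Prop where
  integrableOn : ∀ i : M, MeasureTheory.IntegrableOn (localPart μ i)
    (chartAt (EuclideanSpace ℝ (Fin n)) i).target
  summable : Summable fun i : M =>
    ∫ y in (chartAt (EuclideanSpace ℝ (Fin n)) i).target, |localPart μ i y|

/-- The integral of a density over `M`. -/
def densityIntegral (μ : Dens n M) : ℝ :=
  ∑' i : M, ∫ y in (chartAt (EuclideanSpace ℝ (Fin n)) i).target, localPart μ i y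

end Densities

section OrbitSpaces

variable (Γ : Type*) [Group Γ] {X : Type*} [MulAction Γ X]

/-- The orbit space `Y / Γ` of an (invariant) subset `Y`. -/
def OrbitSpace (Y : Set X) : Type _ :=
  Quotient ((MulAction.orbitRel Γ X).comap (Subtype.val : Y → X))

/-- The projection `Y → Y / Γ`. -/
def OrbitSpace.mk {Y : Set X} (y : Y) : OrbitSpace Γ Y :=
  Quotient.mk ((MulAction.orbitRel Γ X).comap (Subtype.val : Y → X)) y

/-- The map `Y / Γ → Z / Γ` induced by an inclusion `Y ⊆ Z`. -/
def OrbitSpace.inclusion {Y Z : Set X} (h : Y ⊆ Z) : OrbitSpace Γ Y → OrbitSpace Γ Z :=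
  Quotient.lift (fun y : Y => OrbitSpace.mk Γ (Set.inclusion h y)) fun _ _ hab => Quotient.sound hab

/-- `Y` is an invariant subset for `f`. -/
structure IsInvariantSubset (f : X → ℝ) (Y : Set X) : Prop where
  smul_mem : ∀ (g : Γ), ∀ x ∈ Y, g • x ∈ Y
  map_smul : ∀ (g : Γ), ∀ x ∈ Y, f (g • x) = f x

variable {Γ} in
/-- The map `Y / Γ → ℝ` induced by `f`. -/
def IsInvariantSubset.induced {f : X → ℝ} {Y : Set X} (h : IsInvariantSubset Γ f Y) :
    OrbitSpace Γ Y → ℝ :=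
  Quotient.lift (fun y : Y => f y) fun a b hab => by
    obtain ⟨g, hg⟩ := MulAction.orbitRel_apply.1 (Setoid.comap_rel _ _ _ _ |>.1 hab)
    simp only [← hg]
    exact h.map_smul g b b.2

/-- `Y` is an injective invariant subset for `f`. -/
structure IsInjectiveInvariantSubset (f : X → ℝ) (Y : Set X) : Prop where
  invariant : IsInvariantSubset Γ f Y
  injective : Function.Injective invariant.induced

/-- A gauge fixing in `Y`: a section of the projection `Y → Y / Γ`. -/
structure GaugeFixing (Y : Set X) where
  toFun : OrbitSpace Γ Y → Y
  mk_toFun : ∀ c, OrbitSpace.mk Γ (toFun c) = c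

variable {Γ}

/-- The map `Y / Γ → ℝ` obtained by composing `Y / Γ → X₀ / Γ` with the map induced by `f`. -/
def IsInjectiveInvariantSubset.inducedOn {f : X → ℝ} {X₀ Y : Set X}
    (h : IsInjectiveInvariantSubset Γ f X₀) (hY : Y ⊆ X₀) : OrbitSpace Γ Y → ℝ :=
  fun c => h.invariant.induced (OrbitSpace.inclusion Γ hY c)

/-- The map `(D, c) ↦ σ c` from the pullback of `s : C → ℝ` and of the map `Y / Γ → ℝ`. -/
def pullbackEmbed {f : X → ℝ} {X₀ Y : Set X} (h : IsInjectiveInvariantSubset Γ f X₀) (hY : Y ⊆ X₀)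
    {C : Type*} (s : C → ℝ) (σ : GaugeFixing Γ Y) (q : Function.Pullback s (h.inducedOn hY)) : X :=
  σ.toFun q.snd

/-- The subset of `X₀` determined by the pullback and the gauge fixing `σ`. -/
def correctionSubset {f : X → ℝ} {X₀ Y : Set X} (h : IsInjectiveInvariantSubset Γ f X₀) (hY : Y ⊆ X₀)
    {C : Type*} (s : C → ℝ) (σ : GaugeFixing Γ Y) : Set X :=
  Set.range (pullbackEmbed h hY s σ)

end OrbitSpaces

section Theories

variable {n : ℕ}
  {EG : Type*} [NormedAddCommGroup EG] [NormedSpace ℝ EG] [FiniteDimensional ℝ EG]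
  {G : Type*} [TopologicalSpace G] [ChartedSpace EG G] [Group G] [LieGroup 𝓘(ℝ, EG) ∞ G]
  {E : Type*} [NormedAddCommGroup E] [NormedSpace ℝ E] [FiniteDimensional ℝ E]
  {P : Type*} [TopologicalSpace P] [ChartedSpace E P] [IsManifold 𝓘(ℝ, E) ∞ P]
  {M : Type*} [TopologicalSpace M] [ChartedSpace (EuclideanSpace ℝ (Fin n)) M]
  [IsManifold (𝓡 n) ∞ M] [T2Space M] [SigmaCompactSpace M]
  {EG' : Type*} [NormedAddCommGroup EG'] [NormedSpace ℝ EG'] [FiniteDimensional ℝ EG']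
  {G' : Type*} [TopologicalSpace G'] [ChartedSpace EG' G'] [Group G'] [LieGroup 𝓘(ℝ, EG') ∞ G']
  {E' : Type*} [NormedAddCommGroup E'] [NormedSpace ℝ E'] [FiniteDimensional ℝ E']
  {P' : Type*} [TopologicalSpace P'] [ChartedSpace E' P'] [IsManifold 𝓘(ℝ, E') ∞ P']

/-- A Yang-Mills-type theory with instanton sector `B`: an `ℝ`-bilinear pairing of horizontal
equivariant 2-forms with values in the densities on `M`, such that the densities `⟨F_D, F_D⟩` can be
integrated over `M`, so that the action functional is real-valued. -/
structure YMTheory (B : PrincipalBundle n EG G E P M) where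
  pairing : B.OmegaHE 2 →ₗ[ℝ] B.OmegaHE 2 →ₗ[ℝ] Dens n M
  integrable : ∀ D : B.Conn, DensityIntegrable (pairing (B.fieldStrength D) (B.fieldStrength D))

/-- The action functional `S^G(D) = ∫_M ⟨F_D, F_D⟩`. -/
def YMTheory.action {B : PrincipalBundle n EG G E P M} (T : YMTheory B) (D : B.Conn) : ℝ :=
  densityIntegral (T.pairing (B.fieldStrength D) (B.fieldStrength D))

variable (EG G EG' G') in
/-- A basic extension of `G`: an injective homomorphism of Lie groups `G → G'`. -/
structure BasicExtension where
  hom : G →* G'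
  contMDiff_hom : ContMDiff 𝓘(ℝ, EG) 𝓘(ℝ, EG') ∞ hom
  injective_hom : Function.Injective hom

variable (E' P') in
/-- The `G'`-bundle induced from the `G`-bundle `B` by `ι : G → G'`. The associated bundle `P ×_G G'`
is characterized, up to unique isomorphism, as a principal `G'`-bundle over `M` together with a
smooth `ι`-equivariant map from `P` over the identity of `M` (the isomorphism from `P ×_G G'` is then
`[p, g] ↦ incl p · g`). -/
structure InducedBundle (B : PrincipalBundle n EG G E P M) (ι : BasicExtension EG G EG' G') where
  bundle : PrincipalBundle n EG' G' E' P' M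
  incl : P → P'
  contMDiff_incl : ContMDiff 𝓘(ℝ, E) 𝓘(ℝ, E') ∞ incl
  proj_incl : ∀ p, bundle.proj (incl p) = B.proj p
  incl_act : ∀ p g, incl (B.act p g) = bundle.act (incl p) (ι.hom g)

/-- An extension of the Yang-Mills-type theory `T` relative to the basic extension `ι`, where the
extended domain may be any gauge invariant set of 1-forms which contains the connections. The usual
requirement that it consist of equivariant forms is the separate predicate `IsEquivariant`. -/
structure Extension {B : PrincipalBundle n EG G E P M} (T : YMTheory B)
    {ι : BasicExtension EG G EG' G'} (Q : InducedBundle E' P' B ι) where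
  /-- the extended domain -/
  domain : Set (SmoothForm E' P' EG' 1)
  conn_subset : Q.bundle.Conn ⊆ domain
  smul_mem : ∀ (f : Q.bundle.gauge), ∀ α ∈ domain, f • α ∈ domain
  /-- the extended action functional -/
  action : domain → ℝ
  action_smul : ∀ (f : Q.bundle.gauge) (α : domain), action ⟨f • α.1, smul_mem f α.1 α.2⟩ = action α
  /-- the correction subspace -/
  correctionSpace : Set (SmoothForm E' P' EG' 1)
  correctionSpace_subset : correctionSpace ⊆ domain
  /-- the correction functional -/
  correction : correctionSpace → ℝ
  /-- the `δ`-map -/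
  delta : correctionSpace → B.Conn
  decomposition : ∀ α : correctionSpace,
    action (Set.inclusion correctionSpace_subset α) = T.action (delta α) + correction α

namespace Extension

variable {B : PrincipalBundle n EG G E P M} {T : YMTheory B} {ι : BasicExtension EG G EG' G'}
  {Q : InducedBundle E' P' B ι}

/-- The extended domain consists of equivariant 1-forms. -/
def IsEquivariant (e : Extension T Q) : Prop := e.domain ⊆ Q.bundle.equivariantForms

/-- An extension is complete if its correction functional vanishes. -/
def IsComplete (e : Extension T Q) : Prop := ∀ α, e.correction α = 0

end Extension

end Theories

end
end YangMills

namespace YangMills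

/-! ### Orbit spaces and gauge fixings for an arbitrary group action. -/

section OrbitSpaces

variable {Γ : Type*} [Group Γ] {X : Type*} [MulAction Γ X]

/-! Everything takes place in a set `X` with an action of a group `Γ`, a function `f` and subsets `Y
⊆ X₀`; the gauge-theoretic statement is the case where `Y` is the set of connections, `f` is `S` and
`s` is the Yang-Mills action.

Two points of `Y` in the same orbit in `X₀` are already in the same orbit in `Y`, so `Y / Γ → X₀ /
Γ` is injective, and so is its composite with the injective map induced by `f`
(`inducedOn_injective`).

A point `(D, c)` of the pullback satisfies `s D = f (σ c)`, since `σ c` represents the orbit `c` and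
the induced map can be evaluated on any representative (`map_pullbackEmbed`). Thus on the points `σ
c` the function `f` already equals `s` of a companion `D`. Letting `δ` pick such a `D` for each
point gives the decomposition with zero correction.

For two gauge fixings, `σ c ↦ σ' c` is the bijection: the orbits `c` that occur in the pullback do
not depend on the gauge fixing, and a section is injective (`correctionSubsetEquiv`). -/

theorem OrbitSpace.inclusion_injective {Y Z : Set X} (h : Y ⊆ Z) :
    Function.Injective (OrbitSpace.inclusion Γ h) := by
  rintro ⟨a⟩ ⟨b⟩ hab
  -- The equivalence relations on `Y` and on `Z` are both restricted from the one orbit relation on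
  -- `X`, so this relation between the images is, by unfolding, the relation between `a` and `b` in
  -- `Y`.
  have hrel : (MulAction.orbitRel Γ X).comap (Subtype.val : Z → X)
      (Set.inclusion h a) (Set.inclusion h b) := Quotient.exact hab
  exact Quotient.sound hrel

theorem IsInjectiveInvariantSubset.inducedOn_injective {f : X → ℝ} {X₀ Y : Set X}
    (h : IsInjectiveInvariantSubset Γ f X₀) (hY : Y ⊆ X₀) :
    Function.Injective (h.inducedOn hY) :=
  h.injective.comp (OrbitSpace.inclusion_injective hY)

theorem GaugeFixing.injective {Y : Set X} (σ : GaugeFixing Γ Y) : Function.Injective σ.toFun :=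
  Function.LeftInverse.injective σ.mk_toFun

variable {f : X → ℝ} {X₀ Y : Set X} (h : IsInjectiveInvariantSubset Γ f X₀) (hY : Y ⊆ X₀)

/-- Both quotient lifts compute on representatives. This is what allows the induced map to be read
off at the representative chosen by a gauge fixing. -/
theorem IsInjectiveInvariantSubset.inducedOn_mk (y : Y) :
    h.inducedOn hY (OrbitSpace.mk Γ y) = f y := rfl

/-- The core of completeness: the equation defining the pullback is exactly the decomposition of the
extended action with nothing left over. -/
theorem map_pullbackEmbed {C : Type*} (s : C → ℝ) (σ : GaugeFixing Γ Y)
    (q : Function.Pullback s (h.inducedOn hY)) : f (pullbackEmbed h hY s σ q) = s q.fst := by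
  have hq : s q.fst = h.inducedOn hY q.snd := q.2
  -- The orbit `q.snd` is replaced by the class of its own representative, so that the induced map
  -- becomes `f` at that representative.
  rw [hq, ← σ.mk_toFun q.snd, h.inducedOn_mk]
  rfl

theorem correctionSubset_subset {C : Type*} (s : C → ℝ) (σ : GaugeFixing Γ Y) :
    correctionSubset h hY s σ ⊆ X₀ := by
  rintro _ ⟨q, rfl⟩
  exact hY (σ.toFun q.snd).2

/-- `pullbackEmbed` forgets the first component of a pair, so `σ` enters only through the map
applied to a set of orbits in which it does not occur. This separation makes different gauge fixings
comparable. -/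
theorem correctionSubset_eq_image {C : Type*} (s : C → ℝ) (σ : GaugeFixing Γ Y) :
    correctionSubset h hY s σ = (fun c => (σ.toFun c : X)) '' Set.range
      (fun q : Function.Pullback s (h.inducedOn hY) => q.snd) := by
  rw [← Set.range_comp]
  rfl

/-- A gauge fixing identifies its correction subset with the projection of the pullback to the
orbit space. -/
noncomputable def correctionSubsetEquiv {C : Type*} (s : C → ℝ) (σ : GaugeFixing Γ Y) :
    Set.range (fun q : Function.Pullback s (h.inducedOn hY) => q.snd) ≃
      correctionSubset h hY s σ :=
  (Equiv.Set.image _ _ (Subtype.val_injective.comp σ.injective)).trans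
    (Equiv.setCongr (correctionSubset_eq_image h hY s σ).symm)

end OrbitSpaces

end YangMills

/-! ### The complete extension of a Yang-Mills-type theory. -/

theorem mainTheorem5 {n : ℕ}
    {EG : Type*} [NormedAddCommGroup EG] [NormedSpace ℝ EG] [FiniteDimensional ℝ EG]
    {G : Type*} [TopologicalSpace G] [ChartedSpace EG G] [Group G] [LieGroup 𝓘(ℝ, EG) ∞ G]
    {E : Type*} [NormedAddCommGroup E] [NormedSpace ℝ E] [FiniteDimensional ℝ E]
    {P : Type*} [TopologicalSpace P] [ChartedSpace E P] [IsManifold 𝓘(ℝ, E) ∞ P]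
    {M : Type*} [TopologicalSpace M] [ChartedSpace (EuclideanSpace ℝ (Fin n)) M]
    [IsManifold (𝓡 n) ∞ M] [T2Space M] [SigmaCompactSpace M]
    {EG' : Type*} [NormedAddCommGroup EG'] [NormedSpace ℝ EG'] [FiniteDimensional ℝ EG']
    {G' : Type*} [TopologicalSpace G'] [ChartedSpace EG' G'] [Group G'] [LieGroup 𝓘(ℝ, EG') ∞ G']
    {E' : Type*} [NormedAddCommGroup E'] [NormedSpace ℝ E'] [FiniteDimensional ℝ E']
    {P' : Type*} [TopologicalSpace P'] [ChartedSpace E' P'] [IsManifold 𝓘(ℝ, E') ∞ P']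
    (B : YangMills.PrincipalBundle n EG G E P M) (T : YangMills.YMTheory B)
    (ι : YangMills.BasicExtension EG G EG' G') (Q : YangMills.InducedBundle E' P' B ι)
    (S : YangMills.SmoothForm E' P' EG' 1 → ℝ) (X₀ : Set (YangMills.SmoothForm E' P' EG' 1))
    (hconn : Q.bundle.Conn ⊆ X₀)
    (hX₀ : YangMills.IsInjectiveInvariantSubset Q.bundle.gauge S X₀) :
    Function.Injective (hX₀.inducedOn hconn) ∧
    (∀ σ : YangMills.GaugeFixing Q.bundle.gauge Q.bundle.Conn,
      ∃ e : YangMills.Extension T Q,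
        e.domain = X₀ ∧
        (∀ α : e.domain, e.action α = S α) ∧
        e.IsComplete ∧
        e.correctionSpace = YangMills.correctionSubset hX₀ hconn T.action σ ∧
        (∀ α : e.correctionSpace, ∃ q : Function.Pullback T.action (hX₀.inducedOn hconn),
          q.fst = e.delta α ∧ YangMills.pullbackEmbed hX₀ hconn T.action σ q = α) ∧
        (X₀ ⊆ Q.bundle.equivariantForms → e.IsEquivariant)) ∧
    ∀ σ σ' : YangMills.GaugeFixing Q.bundle.gauge Q.bundle.Conn,
      Nonempty (YangMills.correctionSubset hX₀ hconn T.action σ ≃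
        YangMills.correctionSubset hX₀ hconn T.action σ') := by
  -- The bijection passes through the common set of orbits in the pullback: from `σ c` back to `c`,
  -- then on to `σ' c`.
  refine ⟨hX₀.inducedOn_injective hconn, fun σ => ?_, fun σ σ' =>
    ⟨(YangMills.correctionSubsetEquiv hX₀ hconn T.action σ).symm.trans
      (YangMills.correctionSubsetEquiv hX₀ hconn T.action σ')⟩⟩
  -- A choice is needed: `α = σ c` determines `c`, but several connections `D` may have the same
  -- action, and each of them gives a point of the pullback over `α`.
  have hlift : ∀ α : YangMills.correctionSubset hX₀ hconn T.action σ,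
      ∃ q, YangMills.pullbackEmbed hX₀ hconn T.action σ q = α := fun α => α.2
  choose lift hlift using hlift
  exact ⟨{
    domain := X₀
    conn_subset := hconn
    smul_mem := hX₀.invariant.smul_mem
    action := fun α => S α
    action_smul := fun f α => hX₀.invariant.map_smul f α α.2
    correctionSpace := YangMills.correctionSubset hX₀ hconn T.action σ
    correctionSpace_subset := YangMills.correctionSubset_subset hX₀ hconn T.action σ
    correction := 0
    delta := fun α => (lift α).fst
    -- The value of `δ` is the first component of the chosen lift, so its action is the value of `S`
    -- at the image of the lift, which is `α`.
    decomposition := fun α => by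
      simp only [Pi.zero_apply, add_zero]
      rw [← YangMills.map_pullbackEmbed hX₀ hconn T.action σ (lift α), hlift α] },
    -- The lift that defines `δ` also witnesses that `δ` comes from the pullback. The closing `id`
    -- suffices because the domain is `X₀` itself, which makes equivariance of the domain the
    -- assumed inclusion.
    rfl, fun _ => rfl, fun _ => rfl, rfl, fun α => ⟨lift α, rfl, hlift α⟩, id⟩
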